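/- Let $n\ge 0$ be an integer, and let $\lambda=(\lambda_1\ge\cdots\ge\lambda_n\ge 0)$ and $\mu=(\mu_1\ge\cdots\ge\mu_n\ge 0)$ be integer partitions (with zero parts allowed). Let $$s_\lambda(x_1,\dots,x_n)=\frac{\det\bigl[x_i^{\lambda_j+n-j}\bigr]_{i,j=1}^n}{\det\bigl[x_i^{n-j}\bigr]_{i,j=1}^n}$$ be the Schur polynomial (the division is exact in the polynomial ring $\mathbb{R}[x_1,\dots,x_n]$, so that $s_\lambda$ is defined at every point of $\mathbb{R}^n$), and let $$S_\lambda(x)=\frac{s_\lambda(x_1,\dots,x_n)}{s_\lambda(1,\dots,1)}$$ be the normalized Schur function. Write $\lambda\prec\mu$ if $\sum_{i=1}^k\lambda_i\le\sum_{i=1}^k\mu_i$ for $1\le k\le n-1$ and $\sum_{i=1}^n\lambda_i=\sum_{i=1}^n\mu_i$. Then $$S_\lambda(x)\le S_\mu(x)\ \text{ for all } x\in\mathbb{R}^n \text{ with } x_1,\dots,x_n\ge 0\quad\Longleftrightarrow\quad \lambda\prec\mu .$$ -/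

import Mathlib

/-- The determinant `det [x_i ^ (l_j + n - j)]`, `1 ≤ i, j ≤ n` (with 0-based indices the exponent
is `l_j + (n - 1 - j)`). -/
def alternantDet {R : Type*} [CommRing R] {n : ℕ} (x : Fin n → R) (l : Fin n → ℕ) : R :=
  (Matrix.of fun i j : Fin n => x i ^ (l j + (n - 1 - (j : ℕ)))).det

/-- For `l = 0` the determinant is the Vandermonde determinant, up to sign. -/
theorem alternantDet_zero_ne_zero {R : Type*} [CommRing R] [IsDomain R] {n : ℕ} {x : Fin n → R}
    (hx : Function.Injective x) : alternantDet x 0 ≠ 0 := by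
  have h : alternantDet x 0 = Equiv.Perm.sign (Fin.revPerm : Equiv.Perm (Fin n)) *
      (Matrix.vandermonde x).det := by
    rw [← Matrix.det_permute', alternantDet]
    congr 1
    ext i j
    simp only [Matrix.of_apply, Pi.zero_apply, zero_add, Matrix.submatrix_apply, id_eq,
      Matrix.vandermonde_apply, Fin.revPerm_apply, Fin.val_rev]
    congr 1
    omega
  rw [h]
  refine mul_ne_zero ?_ (Matrix.det_vandermonde_ne_zero_iff.mpr hx)
  rcases Int.units_eq_one_or (Equiv.Perm.sign (Fin.revPerm : Equiv.Perm (Fin n))) with h | h <;>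
    simp [h]

/-- The numerator of the Schur polynomial is divisible by its denominator. -/
theorem alternantDet_zero_dvd {R : Type*} [CommRing R] [Nontrivial R] {n : ℕ} (x : Fin n → R)
    (l : Fin n → ℕ) : alternantDet x 0 ∣ alternantDet x l := by
  classical
  set Q : Polynomial R := ∏ i, (Polynomial.X - Polynomial.C (x i)) with hQ
  have hm : Q.Monic := Polynomial.monic_prod_of_monic _ _ fun i _ => Polynomial.monic_X_sub_C _
  have hd : Q.degree = n := by
    rw [hQ, Polynomial.degree_prod_of_monic _ _ fun i _ => Polynomial.monic_X_sub_C _]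
    simp
  let r : Fin n → Polynomial R := fun j => Polynomial.X ^ (l j + (n - 1 - (j : ℕ))) %ₘ Q
  let D : Matrix (Fin n) (Fin n) R := Matrix.of fun k j => (r j).coeff (n - 1 - (k : ℕ))
  have key : ∀ i j, x i ^ (l j + (n - 1 - (j : ℕ))) =
      ∑ k : Fin n, x i ^ (n - 1 - (k : ℕ)) * (r j).coeff (n - 1 - (k : ℕ)) := by
    intro i j
    have hroot : Q.eval (x i) = 0 := by
      rw [hQ, Polynomial.eval_prod]
      exact Finset.prod_eq_zero (Finset.mem_univ i) (by simp)
    have h1 : (r j).eval (x i) = x i ^ (l j + (n - 1 - (j : ℕ))) := by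
      have := congrArg (Polynomial.eval (x i))
        (Polynomial.modByMonic_add_div (Polynomial.X ^ (l j + (n - 1 - (j : ℕ)))) Q)
      simpa [hroot] using this
    have hlt : (r j).degree < n := hd ▸ Polynomial.degree_modByMonic_lt _ hm
    have hn : (r j).natDegree < n := by
      by_cases h0 : r j = 0
      · rw [h0]; simpa using i.pos
      · exact (Polynomial.natDegree_lt_iff_degree_lt h0).mpr hlt
    rw [← h1, Polynomial.eval_eq_sum_range' hn, Finset.sum_range, ← Equiv.sum_comp Fin.revPerm]
    refine Finset.sum_congr rfl fun k _ => ?_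
    have : ((Fin.revPerm k : Fin n) : ℕ) = n - 1 - (k : ℕ) := by
      rw [Fin.revPerm_apply, Fin.val_rev]; omega
    rw [this, mul_comm]
  refine ⟨D.det, ?_⟩
  unfold alternantDet
  rw [← Matrix.det_mul]
  congr 1
  ext i j
  simp [Matrix.mul_apply, D, key i j]

/-- The Schur polynomial `s_l(X_1, …, X_n)`: the quotient of the polynomials
`det [X_i ^ (l_j + n - j)]` and `det [X_i ^ (n - j)]`, the division being exact. -/
noncomputable def schurPoly {n : ℕ} (l : Fin n → ℕ) : MvPolynomial (Fin n) ℝ :=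
  Classical.choose (alternantDet_zero_dvd (MvPolynomial.X : Fin n → MvPolynomial (Fin n) ℝ) l)

theorem schurPoly_spec {n : ℕ} (l : Fin n → ℕ) :
    alternantDet (MvPolynomial.X : Fin n → MvPolynomial (Fin n) ℝ) l =
      alternantDet MvPolynomial.X 0 * schurPoly l :=
  Classical.choose_spec
    (alternantDet_zero_dvd (MvPolynomial.X : Fin n → MvPolynomial (Fin n) ℝ) l)

/-- The defining property of the Schur polynomial determines it. -/
theorem schurPoly_unique {n : ℕ} (l : Fin n → ℕ) {p : MvPolynomial (Fin n) ℝ}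
    (hp : alternantDet (MvPolynomial.X : Fin n → MvPolynomial (Fin n) ℝ) l =
      alternantDet MvPolynomial.X 0 * p) : p = schurPoly l :=
  mul_left_cancel₀ (alternantDet_zero_ne_zero (MvPolynomial.X_injective (R := ℝ)))
    (hp.symm.trans (schurPoly_spec l))

/-- The Schur function `s_l(x_1, …, x_n)` at a real point. -/
noncomputable def schur {n : ℕ} (l : Fin n → ℕ) (x : Fin n → ℝ) : ℝ :=
  MvPolynomial.eval x (schurPoly l)

theorem alternantDet_eq_mul_schur {n : ℕ} (l : Fin n → ℕ) (x : Fin n → ℝ) :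
    alternantDet x l = alternantDet x 0 * schur l x := by
  have h : ∀ m : Fin n → ℕ, MvPolynomial.eval x (alternantDet MvPolynomial.X m) =
      alternantDet x m := by
    intro m
    unfold alternantDet
    rw [RingHom.map_det]
    congr 1
    ext i j
    simp
  have := congrArg (MvPolynomial.eval x) (schurPoly_spec l)
  rwa [map_mul, h, h] at this

/-- At points with distinct coordinates the Schur function is the ratio of determinants. -/
theorem schur_eq_div {n : ℕ} (l : Fin n → ℕ) {x : Fin n → ℝ} (hx : Function.Injective x) :
    schur l x = alternantDet x l / alternantDet x 0 := by
  rw [alternantDet_eq_mul_schur l x, mul_div_cancel_left₀ _ (alternantDet_zero_ne_zero hx)]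

/-- The normalized Schur function `S_l(x) = s_l(x) / s_l(1, …, 1)`. -/
noncomputable def normalizedSchur {n : ℕ} (l : Fin n → ℕ) (x : Fin n → ℝ) : ℝ :=
  schur l x / schur l (fun _ => 1)

/-- `IsMajorizedBy l m` is the relation `l ≺ m` between decreasingly ordered `n`-tuples: the partial
sums of `l` are at most those of `m`, and the total sums are equal. -/
def IsMajorizedBy {R : Type*} [AddCommMonoid R] [LE R] {n : ℕ} (l m : Fin n → R) : Prop :=
  (∀ k : ℕ, 1 ≤ k → k ≤ n - 1 →
    ∑ i ∈ Finset.univ.filter (fun i : Fin n => (i : ℕ) < k), l i ≤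
      ∑ i ∈ Finset.univ.filter (fun i : Fin n => (i : ℕ) < k), m i) ∧
  ∑ i, l i = ∑ i, m i

open MeasureTheory Filter Topology

/-! Put `x_i = exp (a_i)` and `b_j = l_j + n - j`. By the Weyl dimension formula the normalized
Schur function is `expRatio a b` times a positive factor independent of `l` (`normalizedSchur_exp`),
so the question is how `expRatio a b` varies with `b`.

If `l ≺ m`: `expRatio a` is symmetric in `b`, and `expRatio_succ` writes it as an integral over
points interlacing with `a`; iterated, this is an integral of exponentials of linear forms in `b`.
Hence it is log-convex (`expRatio_convex_comb_le`). Moving one unit from a smaller part to a larger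
one replaces `b` by a vector `c` such that `b` is a convex combination of `c` and a transposition of
`c`, so the value cannot decrease. Such moves lead from `l` to `m` (`exists_unit_transfer`).
Continuity covers points with zero or repeated coordinates.

Conversely, for strictly decreasing `a`, `expDet (s a) b` grows like `exp (s ∑ a_i b_i)` as `s → ∞`.
The inequality therefore forces `∑ a_i l_i ≤ ∑ a_i m_i` for every decreasing `a`, and suitable `a`
give the partial sums. -/

/-- The determinant `det [exp (a_i b_j)]`. -/
noncomputable def expDet {n : ℕ} (a b : Fin n → ℝ) : ℝ :=
  (Matrix.of fun i j : Fin n => Real.exp (a i * b j)).det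

/-- The quotient of `det [exp (a_i b_j)]` by the Vandermonde product of `b`. -/
noncomputable def expRatio {n : ℕ} (a b : Fin n → ℝ) : ℝ :=
  expDet a b / alternantDet b 0

/-! ### Vandermonde products and symmetry of the exponential quotient. -/

theorem alternantDet_zero_eq_prod {n : ℕ} (x : Fin n → ℝ) :
    alternantDet x 0 = ∏ i, ∏ j ∈ Finset.Ioi i, (x i - x j) := by
  have h := Matrix.det_projVandermonde (fun _ : Fin n => (1 : ℝ)) x
  simp only [one_mul] at h
  rw [← h, alternantDet]
  congr 1
  ext i j
  simp only [Matrix.of_apply, Pi.zero_apply, zero_add, Matrix.projVandermonde_apply, one_pow,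
    one_mul, Fin.val_rev]
  congr 1
  omega

theorem alternantDet_zero_succ {n : ℕ} (x : Fin (n + 1) → ℝ) :
    alternantDet x 0 = (∏ j : Fin n, (x 0 - x j.succ)) * alternantDet (x ∘ Fin.succ) 0 := by
  simp only [alternantDet_zero_eq_prod, Fin.prod_univ_succ, Fin.prod_Ioi_zero, Fin.prod_Ioi_succ,
    Function.comp_apply]

theorem alternantDet_zero_pos {n : ℕ} {x : Fin n → ℝ} (hx : StrictAnti x) :
    0 < alternantDet x 0 := by
  rw [alternantDet_zero_eq_prod]
  exact Finset.prod_pos fun i _ => Finset.prod_pos fun j hj =>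
    sub_pos.mpr (hx (Finset.mem_Ioi.mp hj))

theorem alternantDet_comp_perm {n : ℕ} (x : Fin n → ℝ) (l : Fin n → ℕ) (σ : Equiv.Perm (Fin n)) :
    alternantDet (x ∘ σ) l = Equiv.Perm.sign σ * alternantDet x l := by
  rw [alternantDet, alternantDet, ← Matrix.det_permute]
  rfl

theorem expDet_comm {n : ℕ} (a b : Fin n → ℝ) : expDet a b = expDet b a := by
  rw [expDet, expDet, ← Matrix.det_transpose]
  congr 1
  ext i j
  simp [mul_comm]

theorem expDet_comp_perm {n : ℕ} (a b : Fin n → ℝ) (σ : Equiv.Perm (Fin n)) :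
    expDet a (b ∘ σ) = Equiv.Perm.sign σ * expDet a b := by
  rw [expDet, expDet, ← Matrix.det_permute']
  rfl

theorem expRatio_comp_perm {n : ℕ} (a b : Fin n → ℝ) (σ : Equiv.Perm (Fin n)) :
    expRatio a (b ∘ σ) = expRatio a b := by
  rw [expRatio, expRatio, expDet_comp_perm, alternantDet_comp_perm]
  refine mul_div_mul_left _ _ ?_
  rcases Int.units_eq_one_or (Equiv.Perm.sign σ) with h | h <;> simp [h]

/-! ### The interlacing integral for `expRatio`. -/

/-- Lebesgue measure on the points `y` that interlace with `a`: `a_{i+1} < y_i ≤ a_i`. -/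
noncomputable def interlaceMeasure {n : ℕ} (a : Fin (n + 1) → ℝ) : Measure (Fin n → ℝ) :=
  Measure.pi fun i => volume.restrict (Set.Ioc (a i.succ) (a i.castSucc))

theorem interlaceMeasure_eq_restrict {n : ℕ} (a : Fin (n + 1) → ℝ) :
    interlaceMeasure a =
      volume.restrict (Set.univ.pi fun i => Set.Ioc (a i.succ) (a i.castSucc)) := by
  rw [interlaceMeasure, ← Measure.restrict_pi_pi]
  rfl

/-- The half-open intervals give `y_{i+1} ≤ a_{i+1} < y_i` throughout the box, so no null set has to
be discarded and `a` may have ties. -/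
theorem ae_interlaceMeasure_strictAnti {n : ℕ} (a : Fin (n + 1) → ℝ) :
    ∀ᵐ y ∂interlaceMeasure a, StrictAnti y := by
  rw [interlaceMeasure_eq_restrict]
  refine ae_restrict_of_forall_mem (MeasurableSet.univ_pi fun i => measurableSet_Ioc) ?_
  intro y hy
  cases n with
  | zero => exact fun i => i.elim0
  | succ n =>
    refine Fin.strictAnti_iff_succ_lt.mpr fun i => ?_
    have h1 := (hy i.succ (Set.mem_univ _)).2
    have h2 := (hy i.castSucc (Set.mem_univ _)).1
    rw [Fin.succ_castSucc] at h2
    exact lt_of_le_of_lt h1 h2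

theorem Continuous.integrable_interlaceMeasure {n : ℕ} (a : Fin (n + 1) → ℝ)
    {f : (Fin n → ℝ) → ℝ} (hf : Continuous f) : Integrable f (interlaceMeasure a) := by
  rw [interlaceMeasure_eq_restrict]
  have h : IntegrableOn f (Set.Icc (fun i : Fin n => a i.succ) (fun i => a i.castSucc)) volume :=
    hf.integrableOn_Icc
  refine h.mono_set fun y hy => ⟨fun i => (hy i (Set.mem_univ _)).1.le,
    fun i => (hy i (Set.mem_univ _)).2⟩

theorem continuous_expDet_left {n : ℕ} (b : Fin n → ℝ) : Continuous fun a => expDet a b := by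
  unfold expDet
  refine Continuous.matrix_det ?_
  fun_prop

/-- Leibniz expansion, with Fubini applied to each product term. -/
theorem det_integral {n : ℕ} (μ : Fin n → Measure ℝ) [∀ i, SigmaFinite (μ i)]
    (f : Fin n → ℝ → ℝ) (hf : ∀ i j, Integrable (f j) (μ i)) :
    (Matrix.of fun i j => ∫ y, f j y ∂μ i).det =
      ∫ y, (Matrix.of fun i j => f j (y i)).det ∂Measure.pi μ := by
  rw [← Matrix.det_transpose, Matrix.det_apply']
  simp_rw [← Matrix.det_transpose (Matrix.of fun i j => f j (_ : ℝ)), Matrix.det_apply']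
  rw [integral_finsetSum]
  · refine Finset.sum_congr rfl fun σ _ => ?_
    rw [integral_const_mul]
    congr 1
    simp only [Matrix.transpose_apply, Matrix.of_apply]
    exact (integral_fintype_prod_eq_prod (fun i => f (σ i))).symm
  · intro σ _
    refine Integrable.const_mul ?_ _
    simp only [Matrix.transpose_apply, Matrix.of_apply]
    exact Integrable.fintype_prod (f := fun i => f (σ i)) fun i => hf i (σ i)

theorem integral_Ioc_exp_mul {s t : ℝ} (h : s ≤ t) (c : ℝ) :
    -c * ∫ y in Set.Ioc s t, Real.exp (y * c) = Real.exp (s * c) - Real.exp (t * c) := by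
  rw [← intervalIntegral.integral_of_le h, ← intervalIntegral.integral_const_mul,
    intervalIntegral.integral_eq_sub_of_hasDerivAt (f := fun y => -Real.exp (y * c))]
  · ring
  · intro y _
    have := (((hasDerivAt_id y).mul_const c).exp).fun_neg
    simpa [mul_comm] using this
  · exact Continuous.intervalIntegrable (by fun_prop) _ _

theorem expDet_sub_const {n : ℕ} (a b : Fin n → ℝ) (t : ℝ) :
    expDet a (fun j => b j - t) = Real.exp (-t * ∑ i, a i) * expDet a b := by
  rw [expDet, expDet, Finset.mul_sum, Real.exp_sum, ← Matrix.det_mul_column]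
  congr 1
  ext i j
  simp only [Matrix.of_apply]
  rw [← Real.exp_add]
  ring_nf

theorem expDet_of_head_eq_zero {n : ℕ} {a b : Fin (n + 1) → ℝ} (ha : Antitone a) (hb : b 0 = 0) :
    expDet a b = (∏ j : Fin n, -b j.succ) * ∫ y, expDet y (b ∘ Fin.succ) ∂interlaceMeasure a := by
  let A : Matrix (Fin (n + 1)) (Fin (n + 1)) ℝ := Matrix.of fun i j => Real.exp (a i * b j)
  -- Differences of consecutive rows: as `b 0 = 0`, column 0 of `A` is constantly 1, so that of `B`
  -- is `(1, 0, …, 0)`. The remaining entries are integrals over the interlacing intervals.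
  let B : Matrix (Fin (n + 1)) (Fin (n + 1)) ℝ :=
    Matrix.of (Fin.cons (A 0) fun i : Fin n => fun j => A i.succ j - A i.castSucc j)
  have hAB : A.det = B.det :=
    Matrix.det_eq_of_forall_row_eq_smul_add_pred (fun _ => 1) (fun j => rfl) fun i j => by
      simp [B]
  have hB : B.det = (B.submatrix Fin.succ Fin.succ).det := by
    rw [Matrix.det_succ_column_zero, Fin.sum_univ_succ, Finset.sum_eq_zero]
    · simp [B, A, hb]
    · intro i _
      simp [B, A, hb]
  have hint : (B.submatrix Fin.succ Fin.succ).det = (Matrix.of fun i j : Fin n => -b j.succ *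
      (Matrix.of fun i j : Fin n => ∫ y in Set.Ioc (a i.succ) (a i.castSucc),
        Real.exp (y * b j.succ)) i j).det := by
    congr 1
    ext i j
    simp only [Matrix.of_apply, Matrix.submatrix_apply]
    rw [integral_Ioc_exp_mul (ha i.castSucc_lt_succ.le)]
    simp [B, A]
  rw [expDet, show (Matrix.of fun i j => Real.exp (a i * b j)) = A from rfl, hAB, hB, hint,
    Matrix.det_mul_row, det_integral _ fun j y => Real.exp (y * b j.succ)]
  · rfl
  · intro i j
    have : Continuous fun y : ℝ => Real.exp (y * b j.succ) := by fun_prop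
    exact (this.integrableOn_Icc (a := a i.succ) (b := a i.castSucc)).mono_set
      Set.Ioc_subset_Icc_self

/-- Translating `b` by `b 0` reduces to a zero head at the cost of an exponential factor; the
product `∏ (b 0 - b j.succ)` then cancels against the first factor of the Vandermonde product. -/
theorem expRatio_succ {n : ℕ} {a b : Fin (n + 1) → ℝ} (ha : Antitone a)
    (hb : Function.Injective b) :
    expRatio a b = ∫ y, Real.exp (b 0 * (∑ i, a i - ∑ i, y i)) *
      expRatio y (b ∘ Fin.succ) ∂interlaceMeasure a := by
  have h0 : (∏ j : Fin n, (b 0 - b j.succ)) ≠ 0 :=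
    Finset.prod_ne_zero_iff.mpr fun j _ => sub_ne_zero.mpr (hb.ne (Fin.succ_ne_zero j).symm)
  have h1 := expDet_sub_const a b (b 0)
  rw [expDet_of_head_eq_zero ha (by simp)] at h1
  have h2 : expDet a b = (∏ j : Fin n, (b 0 - b j.succ)) *
      ∫ y, Real.exp (b 0 * (∑ i, a i - ∑ i, y i)) * expDet y (b ∘ Fin.succ)
        ∂interlaceMeasure a := by
    have h3 : expDet a b = Real.exp (b 0 * ∑ i, a i) *
        (Real.exp (-b 0 * ∑ i, a i) * expDet a b) := by
      rw [← mul_assoc, ← Real.exp_add]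
      simp
    rw [h3, ← h1, mul_left_comm, ← integral_const_mul]
    congr 1
    · exact Finset.prod_congr rfl fun j _ => by ring
    · refine integral_congr_ae (Eventually.of_forall fun y => ?_)
      have := expDet_sub_const y (b ∘ Fin.succ) (b 0)
      simp only [Function.comp_def] at this ⊢
      rw [this, ← mul_assoc, ← Real.exp_add]
      ring_nf
  rw [expRatio, alternantDet_zero_succ, h2, mul_div_mul_left _ _ h0, ← integral_div]
  simp only [expRatio, mul_div_assoc]

/-! ### Log-convexity in the exponents. -/

/-- A weighted form of the logarithmic convexity of `expRatio a`. -/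
theorem expRatio_convex_comb_le {θ : ℝ} (h0 : 0 ≤ θ) (h1 : θ ≤ 1) : ∀ {n : ℕ}
    {a b c d : Fin n → ℝ}, StrictAnti a → Function.Injective b → Function.Injective c →
    Function.Injective d → (∀ i, b i = θ * c i + (1 - θ) * d i) → ∀ u : ℝ,
    expRatio a b ≤ θ * Real.exp ((1 - θ) * u) * expRatio a c +
      (1 - θ) * Real.exp (-θ * u) * expRatio a d := by
  intro n
  induction n with
  | zero =>
    intro a b c d _ _ _ _ _ u
    -- The empty quotient is 1, and 0 is the weighted mean of `(1 - θ) * u` and `-θ * u`.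
    have h := convexOn_exp.2 (Set.mem_univ ((1 - θ) * u)) (Set.mem_univ (-θ * u)) h0
      (sub_nonneg.mpr h1) (by ring)
    simp only [smul_eq_mul] at h
    rw [show θ * ((1 - θ) * u) + (1 - θ) * (-θ * u) = 0 by ring, Real.exp_zero] at h
    simpa [expRatio, expDet, alternantDet] using h
  | succ n ih =>
    intro a b c d ha hb hc hd hbcd u
    have hcont : ∀ e : Fin (n + 1) → ℝ, Continuous fun y : Fin n → ℝ =>
        Real.exp (e 0 * (∑ i, a i - ∑ i, y i)) * expRatio y (e ∘ Fin.succ) := fun e =>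
      Continuous.mul (by fun_prop) ((continuous_expDet_left _).div_const _)
    have hint := fun e => (hcont e).integrable_interlaceMeasure a
    rw [expRatio_succ ha.antitone hb, expRatio_succ ha.antitone hc, expRatio_succ ha.antitone hd,
      ← integral_const_mul, ← integral_const_mul,
      ← integral_add ((hint c).const_mul _) ((hint d).const_mul _)]
    refine integral_mono_ae (hint b) (((hint c).const_mul _).add ((hint d).const_mul _)) ?_
    filter_upwards [ae_interlaceMeasure_strictAnti a] with y hy
    set s := ∑ i, a i - ∑ i, y i with hs
    -- Minimizing over `u` would give `F(c)^θ F(d)^(1-θ)`, but the form with `u` is linear in both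
    -- values and so survives integration without Hölder. Shifting `u` absorbs the factor `exp (b 0
    -- * s)`; plain convexity would not pass through that product.
    have := ih hy (hb.comp (Fin.succ_injective n)) (hc.comp (Fin.succ_injective n))
      (hd.comp (Fin.succ_injective n)) (fun i => hbcd i.succ) (u + (c 0 - d 0) * s)
    refine (mul_le_mul_of_nonneg_left this (Real.exp_pos (b 0 * s)).le).trans_eq ?_
    have e1 : Real.exp (b 0 * s) * Real.exp ((1 - θ) * (u + (c 0 - d 0) * s)) =
        Real.exp ((1 - θ) * u) * Real.exp (c 0 * s) := by
      rw [← Real.exp_add, ← Real.exp_add, hbcd 0]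
      ring_nf
    have e2 : Real.exp (b 0 * s) * Real.exp (-θ * (u + (c 0 - d 0) * s)) =
        Real.exp (-θ * u) * Real.exp (d 0 * s) := by
      rw [← Real.exp_add, ← Real.exp_add, hbcd 0]
      ring_nf
    linear_combination θ * expRatio y (c ∘ Fin.succ) * e1 +
      (1 - θ) * expRatio y (d ∘ Fin.succ) * e2

/-! ### Unit transfers in the dominance order. -/

/-- For partitions `l`, `m` with `l ≺ m` there is a unit transfer that stays below `m`. -/
theorem exists_unit_transfer {n : ℕ} {l m : ℕ → ℕ} (hl : Antitone l) (hm : Antitone m)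
    (hle : ∀ k, ∑ x ∈ Finset.range k, l x ≤ ∑ x ∈ Finset.range k, m x)
    (heq : ∑ x ∈ Finset.range n, l x = ∑ x ∈ Finset.range n, m x)
    (htail : ∀ k, n ≤ k → l k = m k) (hne : l ≠ m) :
    ∃ (i j : ℕ) (c : ℕ → ℕ), i < j ∧ j < n ∧ Antitone c ∧ c i = l i + 1 ∧ l j = c j + 1 ∧
      (∀ k, k ≠ i → k ≠ j → c k = l k) ∧
      (∀ k, ∑ x ∈ Finset.range k, l x ≤ ∑ x ∈ Finset.range k, c x) ∧
      ∑ x ∈ Finset.range j, l x < ∑ x ∈ Finset.range j, c x ∧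
      (∀ k, ∑ x ∈ Finset.range k, c x ≤ ∑ x ∈ Finset.range k, m x) ∧
      ∑ x ∈ Finset.range n, c x = ∑ x ∈ Finset.range n, l x := by
  have hex : ∃ i, l i ≠ m i := Function.ne_iff.mp hne
  classical
  -- The unit goes to the first place `i` where `l` and `m` differ.
  obtain ⟨i, hi, himin⟩ : ∃ i, l i ≠ m i ∧ ∀ k < i, l k = m k :=
    ⟨Nat.find hex, Nat.find_spec hex, fun k hk => not_not.mp (Nat.find_min hex hk)⟩
  have hin : i < n := by
    by_contra h
    exact hi (htail i (not_lt.mp h))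
  have hpre : ∑ x ∈ Finset.range i, l x = ∑ x ∈ Finset.range i, m x :=
    Finset.sum_congr rfl fun k hk => himin k (Finset.mem_range.mp hk)
  have hilt : l i < m i := by
    have := hle (i + 1)
    rw [Finset.sum_range_succ, Finset.sum_range_succ] at this
    omega
  have hex2 : ∃ k, i < k ∧ ∑ x ∈ Finset.range (k + 1), l x = ∑ x ∈ Finset.range (k + 1), m x := by
    -- The common tail makes `n` a witness; `j = n` itself is excluded later, because `m j < l j`.
    refine ⟨n, hin, ?_⟩
    rw [Finset.sum_range_succ, Finset.sum_range_succ, heq, htail n le_rfl]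
  -- The unit is taken from the first `j > i` at which the partial sums agree again. They are
  -- strictly ordered in between, so there is room for one more unit.
  obtain ⟨j, ⟨hij, hj⟩, hjmin⟩ : ∃ j, (i < j ∧
      ∑ x ∈ Finset.range (j + 1), l x = ∑ x ∈ Finset.range (j + 1), m x) ∧
      ∀ k, i < k → k < j → ∑ x ∈ Finset.range (k + 1), l x < ∑ x ∈ Finset.range (k + 1), m x :=
    ⟨Nat.find hex2, Nat.find_spec hex2, fun k hik hk =>
      lt_of_le_of_ne (hle _) fun h => Nat.find_min hex2 hk ⟨hik, h⟩⟩
  have hstrict : ∀ k, i < k → k ≤ j →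
      ∑ x ∈ Finset.range k, l x < ∑ x ∈ Finset.range k, m x := by
    intro k hik hkj
    obtain ⟨k, rfl⟩ : ∃ k', k = k' + 1 := ⟨k - 1, by omega⟩
    rcases Nat.lt_or_ge i k with h | h
    · exact hjmin k h hkj
    · obtain rfl : k = i := by omega
      rw [Finset.sum_range_succ, Finset.sum_range_succ]
      omega
  have hjlt : m j < l j := by
    have := hstrict j hij le_rfl
    rw [Finset.sum_range_succ, Finset.sum_range_succ] at hj
    omega
  have hjn : j < n := by
    by_contra h
    have := htail j (not_lt.mp h)
    omega
  have hj1 : l (j + 1) < l j := by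
    have h1 := hle (j + 1 + 1)
    rw [Finset.sum_range_succ, Finset.sum_range_succ _ (j + 1), hj] at h1
    have : m (j + 1) ≤ m j := hm (Nat.le_succ j)
    omega
  have hi1 : ∀ k, k + 1 = i → l (k + 1) < l k := by
    intro k hk
    rw [hk]
    have h1 := himin k (by omega)
    have h2 := hm (show k ≤ i by omega)
    omega
  let c : ℕ → ℕ := fun k => if k = i then l k + 1 else if k = j then l k - 1 else l k
  have hsum : ∀ k, ∑ x ∈ Finset.range k, c x =
      ∑ x ∈ Finset.range k, l x + (if i < k ∧ k ≤ j then 1 else 0) := by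
    intro k
    induction k with
    | zero => simp
    | succ k ih =>
      rw [Finset.sum_range_succ, Finset.sum_range_succ, ih]
      simp only [c]
      rcases eq_or_ne k j with rfl | hkj
      · split_ifs <;> omega
      · split_ifs <;> omega
  refine ⟨i, j, c, hij, hjn, antitone_nat_of_succ_le fun k => ?_, by simp [c], ?_, ?_, ?_, ?_, ?_, ?_⟩
  · have h1 : l (k + 1) ≤ l k := hl (Nat.le_succ k)
    have h2 := hi1 k
    simp only [c]
    rcases eq_or_ne k j with rfl | hkj
    · split_ifs <;> omega
    · split_ifs <;> omega
  · simp only [c, if_neg hij.ne', if_true]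
    omega
  · intro k h1 h2
    simp [c, h1, h2]
  · intro k
    rw [hsum]
    omega
  · rw [hsum, if_pos ⟨hij, le_rfl⟩]
    omega
  · intro k
    rw [hsum]
    split_ifs with h
    · exact hstrict k h.1 h.2
    · exact hle k
  · rw [hsum, if_neg (by omega), add_zero]

/-- A function that increases under unit transfers is monotone for the dominance order. -/
theorem le_of_unit_transfer_le {n : ℕ} (f : (ℕ → ℕ) → ℝ)
    (hf : ∀ (l c : ℕ → ℕ) (i j : ℕ), Antitone l → Antitone c → i < j → j < n → c i = l i + 1 →
      l j = c j + 1 → (∀ k, k ≠ i → k ≠ j → c k = l k) → f l ≤ f c)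
    {m : ℕ → ℕ} (hm : Antitone m) {l : ℕ → ℕ} (hl : Antitone l)
    (hle : ∀ k, ∑ x ∈ Finset.range k, l x ≤ ∑ x ∈ Finset.range k, m x)
    (heq : ∑ x ∈ Finset.range n, l x = ∑ x ∈ Finset.range n, m x)
    (htail : ∀ k, n ≤ k → l k = m k) : f l ≤ f m := by
  -- The measure is the total gap between partial sums. The truncated subtraction is exact here by
  -- `hle`.
  induction hd : ∑ k ∈ Finset.range n,
      (∑ x ∈ Finset.range k, m x - ∑ x ∈ Finset.range k, l x) using Nat.strong_induction_on
    generalizing l with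
  | _ d ih =>
    rcases eq_or_ne l m with rfl | hne
    · exact le_rfl
    obtain ⟨i, j, c, hij, hjn, hc, hci, hlj, hck, hlc, hlcj, hcm, hcn⟩ :=
      exists_unit_transfer hl hm hle heq htail hne
    refine (hf l c i j hl hc hij hjn hci hlj hck).trans
      (ih _ ?_ hc hcm (hcn.trans heq) (fun k hk => ?_) rfl)
    · rw [← hd]
      refine Finset.sum_lt_sum (fun k _ => Nat.sub_le_sub_left (hlc k) _)
        ⟨j, Finset.mem_range.mpr hjn, ?_⟩
      have := hcm j
      omega
    · rw [hck k (by omega) (by omega), htail k hk]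

/-! ### Schur functions at exponential points. -/

/-- The strictly decreasing exponents `l_j + n - j` of the numerator of the Schur function. -/
def shiftedPart {n : ℕ} (l : Fin n → ℕ) (j : Fin n) : ℝ :=
  ((l j + (n - 1 - (j : ℕ)) : ℕ) : ℝ)

theorem shiftedPart_strictAnti {n : ℕ} {l : Fin n → ℕ} (hl : Antitone l) :
    StrictAnti (shiftedPart l) := by
  intro i j hij
  have h1 := hl hij.le
  have h2 := Fin.lt_def.mp hij
  have h3 := j.isLt
  exact Nat.cast_lt.mpr (by omega)

theorem shiftedPart_zero_strictAnti {n : ℕ} : StrictAnti (shiftedPart (0 : Fin n → ℕ)) :=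
  shiftedPart_strictAnti fun _ _ _ => le_rfl

theorem shiftedPart_eq_add {n : ℕ} (l : Fin n → ℕ) (j : Fin n) :
    shiftedPart l j = l j + shiftedPart 0 j := by
  simp [shiftedPart]

theorem alternantDet_exp {n : ℕ} (a : Fin n → ℝ) (l : Fin n → ℕ) :
    alternantDet (fun i => Real.exp (a i)) l = expDet a (shiftedPart l) := by
  rw [alternantDet, expDet]
  congr 1
  ext i j
  simp only [Matrix.of_apply, shiftedPart]
  rw [← Real.exp_nat_mul, mul_comm]

theorem continuous_schur {n : ℕ} (l : Fin n → ℕ) : Continuous (schur l) :=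
  MvPolynomial.continuous_eval _

theorem continuous_normalizedSchur {n : ℕ} (l : Fin n → ℕ) : Continuous (normalizedSchur l) :=
  (continuous_schur l).div_const _

theorem tendsto_alternantDet_exp_mul {n : ℕ} (b : Fin n → ℝ) :
    Tendsto (fun t : ℝ => alternantDet (fun i => Real.exp (t * b i)) 0 /
      ∏ i : Fin n, ∏ _j ∈ Finset.Ioi i, t) (𝓝[≠] 0) (𝓝 (alternantDet b 0)) := by
  simp only [alternantDet_zero_eq_prod, ← Finset.prod_div_distrib]
  refine tendsto_finsetProd _ fun i _ => tendsto_finsetProd _ fun j _ => ?_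
  have h : HasDerivAt (fun t : ℝ => Real.exp (t * b i) - Real.exp (t * b j)) (b i - b j) 0 := by
    have := fun k => ((hasDerivAt_id (0 : ℝ)).mul_const (b k)).exp
    simpa using (this i).fun_sub (this j)
  have := h.tendsto_slope
  simpa [slope_fun_def, div_eq_inv_mul] using this

/-- The Weyl dimension formula. -/
theorem alternantDet_shiftedPart_eq_mul_schur_one {n : ℕ} (l : Fin n → ℕ) :
    alternantDet (shiftedPart l) 0 =
      alternantDet (shiftedPart (0 : Fin n → ℕ)) 0 * schur l fun _ => 1 := by
  -- Principal specialization: at `x_i = exp (t δ_i)`, with `δ = shiftedPart 0`, the numerator is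
  -- also a Vandermonde determinant, by the symmetry of `expDet`. Both determinants are then divided
  -- by the same power of `t` and `t → 0`.
  have key : ∀ t : ℝ, alternantDet (fun i => Real.exp (t * shiftedPart l i)) 0 =
      alternantDet (fun i => Real.exp (t * shiftedPart (0 : Fin n → ℕ) i)) 0 *
        schur l fun i => Real.exp (t * shiftedPart (0 : Fin n → ℕ) i) := by
    intro t
    rw [← alternantDet_eq_mul_schur, alternantDet_exp, alternantDet_exp, expDet_comm, expDet, expDet]
    simp only [mul_left_comm, mul_assoc]
  have h1 := tendsto_alternantDet_exp_mul (shiftedPart l)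
  have h2 := tendsto_alternantDet_exp_mul (shiftedPart (0 : Fin n → ℕ))
  have h3 : Tendsto (fun t : ℝ => schur l fun i => Real.exp (t * shiftedPart (0 : Fin n → ℕ) i))
      (𝓝[≠] 0) (𝓝 (schur l fun _ => 1)) := by
    have : Continuous fun t : ℝ =>
        schur l fun i => Real.exp (t * shiftedPart (0 : Fin n → ℕ) i) :=
      (continuous_schur l).comp (by fun_prop)
    simpa using (this.tendsto 0).mono_left nhdsWithin_le_nhds
  refine tendsto_nhds_unique h1 ((h2.mul h3).congr fun t => ?_)
  rw [key]
  ring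

theorem normalizedSchur_exp {n : ℕ} (l : Fin n → ℕ) {a : Fin n → ℝ} (ha : Function.Injective a) :
    normalizedSchur l (fun i => Real.exp (a i)) = expRatio a (shiftedPart l) *
      (alternantDet (shiftedPart (0 : Fin n → ℕ)) 0 / alternantDet (fun i => Real.exp (a i)) 0) := by
  have h0 := (alternantDet_zero_pos (shiftedPart_zero_strictAnti (n := n))).ne'
  have h1 : schur l (fun _ => 1) =
      alternantDet (shiftedPart l) 0 / alternantDet (shiftedPart (0 : Fin n → ℕ)) 0 := by
    rw [alternantDet_shiftedPart_eq_mul_schur_one, mul_div_cancel_left₀ _ h0]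
  have hinj : Function.Injective fun i => Real.exp (a i) := Real.exp_injective.comp ha
  rw [normalizedSchur, schur_eq_div l hinj, h1, expRatio, alternantDet_exp]
  simp only [div_eq_mul_inv, mul_inv, inv_inv]
  ring

theorem normalizedSchur_exp_le_iff {n : ℕ} (l m : Fin n → ℕ) {a : Fin n → ℝ} (ha : StrictAnti a) :
    normalizedSchur l (fun i => Real.exp (a i)) ≤ normalizedSchur m (fun i => Real.exp (a i)) ↔
      expRatio a (shiftedPart l) ≤ expRatio a (shiftedPart m) := by
  rw [normalizedSchur_exp l ha.injective, normalizedSchur_exp m ha.injective]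
  refine mul_le_mul_iff_left₀ (div_pos (alternantDet_zero_pos shiftedPart_zero_strictAnti)
    (alternantDet_zero_pos fun i j hij => Real.exp_lt_exp.mpr (ha hij)))

theorem normalizedSchur_comp_perm {n : ℕ} (l : Fin n → ℕ) {x : Fin n → ℝ}
    (hx : Function.Injective x) (σ : Equiv.Perm (Fin n)) :
    normalizedSchur l (x ∘ σ) = normalizedSchur l x := by
  rw [normalizedSchur, normalizedSchur, schur_eq_div l hx, schur_eq_div l (hx.comp σ.injective),
    alternantDet_comp_perm, alternantDet_comp_perm, mul_div_mul_left]
  rcases Int.units_eq_one_or (Equiv.Perm.sign σ) with h | h <;> simp [h]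

/-! ### Majorization implies the inequality. -/

theorem expRatio_le_of_unit_transfer {n : ℕ} {a : Fin n → ℝ} (ha : StrictAnti a)
    {l c : Fin n → ℕ} (hl : Antitone l) (hc : Antitone c) {i j : Fin n} (hij : i < j)
    (hi : c i = l i + 1) (hj : l j = c j + 1) (hk : ∀ k, k ≠ i → k ≠ j → c k = l k) :
    expRatio a (shiftedPart l) ≤ expRatio a (shiftedPart c) := by
  have hib : shiftedPart c i = shiftedPart l i + 1 := by
    rw [shiftedPart_eq_add, shiftedPart_eq_add l, hi]; push_cast; ring
  have hjb : shiftedPart l j = shiftedPart c j + 1 := by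
    rw [shiftedPart_eq_add, shiftedPart_eq_add c, hj]; push_cast; ring
  have hlt := shiftedPart_strictAnti hl hij
  set d := shiftedPart c i - shiftedPart c j with hd
  have hd1 : 1 < d := by linarith
  have hd0 : d ≠ 0 := by linarith
  -- Mixing in the swapped vector with weight `1/d` moves the entries `i` and `j` towards each other
  -- by exactly `(1/d) * d = 1`. Symmetry makes both values on the right equal, and `u = 0`
  -- suffices.
  have h := expRatio_convex_comb_le (θ := 1 - d⁻¹) (sub_nonneg.mpr (inv_le_one_of_one_le₀ hd1.le))
    (sub_le_self _ (inv_nonneg.mpr (by linarith))) ha (shiftedPart_strictAnti hl).injective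
    (shiftedPart_strictAnti hc).injective
    ((shiftedPart_strictAnti hc).injective.comp (Equiv.swap i j).injective) (fun k => ?_) 0
  · rw [expRatio_comp_perm] at h
    simp only [mul_zero, Real.exp_zero, mul_one] at h
    linarith
  · have hmul : d⁻¹ * (shiftedPart c i - shiftedPart c j) = 1 := inv_mul_cancel₀ hd0
    simp only [Function.comp_apply]
    rcases eq_or_ne k i with rfl | hki
    · rw [Equiv.swap_apply_left]
      linarith
    · rcases eq_or_ne k j with rfl | hkj
      · rw [Equiv.swap_apply_right]
        linarith
      · rw [Equiv.swap_apply_of_ne_of_ne hki hkj, shiftedPart_eq_add, shiftedPart_eq_add c,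
          hk k hki hkj]
        ring

theorem sum_filter_val_lt {M : Type*} [AddCommMonoid M] {n k : ℕ} (hk : k ≤ n) (f : ℕ → M) :
    ∑ i ∈ Finset.univ.filter (fun i : Fin n => (i : ℕ) < k), f i = ∑ x ∈ Finset.range k, f x := by
  rw [Finset.sum_filter, Fin.sum_univ_eq_sum_range (fun x => if x < k then f x else 0),
    ← Finset.sum_filter]
  congr 1
  ext x
  simp only [Finset.mem_filter, Finset.mem_range]
  omega

theorem expRatio_le_of_isMajorizedBy {n : ℕ} {a : Fin n → ℝ} (ha : StrictAnti a)
    {l m : Fin n → ℕ} (hl : Antitone l) (hm : Antitone m) (h : IsMajorizedBy l m) :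
    expRatio a (shiftedPart l) ≤ expRatio a (shiftedPart m) := by
  -- Extension by zero keeps the sequences decreasing and the partial sums constant from `n` on.
  let e : (Fin n → ℕ) → ℕ → ℕ := fun p k => if h : k < n then p ⟨k, h⟩ else 0
  have he : ∀ p, (fun i : Fin n => e p i) = p := fun p => by
    ext i
    simp [e]
  have hanti : ∀ p : Fin n → ℕ, Antitone p → Antitone (e p) := by
    intro p hp s t hst
    by_cases ht : t < n
    · simp only [e, dif_pos ht, dif_pos (hst.trans_lt ht)]
      exact hp hst
    · simp [e, ht]
  have hsum : ∀ p k, k ≤ n → ∑ x ∈ Finset.range k, e p x =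
      ∑ i ∈ Finset.univ.filter (fun i : Fin n => (i : ℕ) < k), p i := by
    intro p k hk
    rw [← sum_filter_val_lt hk (e p)]
    exact Finset.sum_congr rfl fun i _ => congrFun (he p) i
  have hall : ∀ p k, n ≤ k → ∑ x ∈ Finset.range k, e p x = ∑ i, p i := by
    intro p k hk
    have : ∑ i, p i = ∑ x ∈ Finset.range n, e p x := by
      rw [hsum p n le_rfl, Finset.filter_true_of_mem fun i _ => i.isLt]
    rw [this]
    refine (Finset.sum_subset (Finset.range_mono hk) fun x _ hx => ?_).symm
    simp only [Finset.mem_range] at hx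
    simp [e, hx]
  have hmain := le_of_unit_transfer_le (n := n)
    (fun g => expRatio a (shiftedPart fun i : Fin n => g i)) ?_ (hanti m hm) (hanti l hl) ?_ ?_ ?_
  · simpa only [he] using hmain
  · intro g c i j hg hc hij hjn hi hj hk
    exact expRatio_le_of_unit_transfer ha (i := ⟨i, hij.trans hjn⟩) (j := ⟨j, hjn⟩)
      (fun s t hst => hg hst) (fun s t hst => hc hst) hij hi hj fun k h1 h2 =>
        hk k (fun h => h1 (Fin.ext h)) fun h => h2 (Fin.ext h)
  · intro k
    rcases Nat.eq_zero_or_pos k with rfl | hk0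
    · simp
    · rcases Nat.lt_or_ge k n with hkn | hkn
      · rw [hsum _ _ hkn.le, hsum _ _ hkn.le]
        exact h.1 k hk0 (by omega)
      · rw [hall _ _ hkn, hall _ _ hkn, h.2]
  · rw [hall _ _ le_rfl, hall _ _ le_rfl, h.2]
  · intro k hk
    simp [e, not_lt.mpr hk]

theorem normalizedSchur_le_of_isMajorizedBy {n : ℕ} {l m : Fin n → ℕ} (hl : Antitone l)
    (hm : Antitone m) (h : IsMajorizedBy l m) {x : Fin n → ℝ} (hx : ∀ i, 0 ≤ x i) :
    normalizedSchur l x ≤ normalizedSchur m x := by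
  let σ : Equiv.Perm (Fin n) := Fin.revPerm.trans (Tuple.sort x)
  have hσ : Antitone (x ∘ σ) := fun i j hij =>
    Tuple.monotone_sort x (Fin.rev_le_rev.mpr hij)
  -- A positive direction, strictly decreasing in the sorted order of `x`: for `t > 0` the point `x
  -- + t d` has positive, distinct coordinates.
  let d : Fin n → ℝ := fun i => 1 + shiftedPart (0 : Fin n → ℕ) (σ.symm i)
  have hd : ∀ i, 0 < d i := fun i => add_pos_of_pos_of_nonneg one_pos (Nat.cast_nonneg _)
  have key : ∀ t : ℝ, 0 < t → normalizedSchur l (fun i => x i + t * d i) ≤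
      normalizedSchur m (fun i => x i + t * d i) := by
    intro t ht
    set y : Fin n → ℝ := fun i => x i + t * d i with hy
    have hy0 : ∀ i, 0 < y i := fun i => add_pos_of_nonneg_of_pos (hx i) (mul_pos ht (hd i))
    have hyσ : StrictAnti (y ∘ σ) := fun i j hij => by
      have h1 := hσ hij.le
      have h2 := mul_lt_mul_of_pos_left (shiftedPart_zero_strictAnti hij) ht
      simp only [Function.comp_apply] at h1
      simp only [hy, d, Function.comp_apply, Equiv.symm_apply_apply]
      linarith
    have hinj : Function.Injective y := by
      have := hyσ.injective.comp σ.symm.injective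
      rwa [Function.comp_assoc, Equiv.self_comp_symm, Function.comp_id] at this
    rw [← normalizedSchur_comp_perm l hinj σ, ← normalizedSchur_comp_perm m hinj σ]
    have hlog : y ∘ σ = fun i => Real.exp (Real.log (y (σ i))) :=
      funext fun i => (Real.exp_log (hy0 _)).symm
    have ha : StrictAnti fun i => Real.log (y (σ i)) := fun i j hij =>
      Real.log_lt_log (hy0 _) (hyσ hij)
    rw [hlog, normalizedSchur_exp_le_iff l m ha]
    exact expRatio_le_of_isMajorizedBy ha hl hm h
  have hlim : ∀ p : Fin n → ℕ, Tendsto (fun t : ℝ => normalizedSchur p fun i => x i + t * d i)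
      (𝓝[>] 0) (𝓝 (normalizedSchur p x)) := by
    intro p
    have : Continuous fun t : ℝ => normalizedSchur p fun i => x i + t * d i :=
      (continuous_normalizedSchur p).comp (by fun_prop)
    simpa using (this.tendsto 0).mono_left nhdsWithin_le_nhds
  exact le_of_tendsto_of_tendsto (hlim l) (hlim m)
    (eventually_nhdsWithin_of_forall fun t ht => key t ht)

/-! ### The inequality implies majorization. -/

theorem sum_mul_comp_perm_lt_of_strictAnti {n : ℕ} {a b : Fin n → ℝ} (ha : StrictAnti a)
    (hb : StrictAnti b) {σ : Equiv.Perm (Fin n)} (hσ : σ ≠ 1) :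
    ∑ i, a i * b (σ i) < ∑ i, a i * b i := by
  have hmono : Monovary a b := fun i j hij => ha.antitone (hb.lt_iff_gt.mp hij).le
  refine hmono.sum_mul_comp_perm_lt_sum_mul_iff.mpr fun h => hσ ?_
  have hσmono : StrictMono σ := by
    intro i j hij
    by_contra hcon
    have h1 : σ j < σ i := lt_of_le_of_ne (not_lt.mp hcon) (σ.injective.ne hij.ne')
    exact absurd (h (hb h1)) (not_le.mpr (ha hij))
  ext i
  exact congrArg Fin.val
    (DFunLike.congr_fun (Subsingleton.elim (hσmono.orderIsoOfSurjective σ σ.surjective)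
      (OrderIso.refl (Fin n))) i)

/-- In the Leibniz expansion the identity permutation has the strictly largest exponent, by the
rearrangement inequality. -/
theorem tendsto_expDet_mul_exp_neg {n : ℕ} {a b : Fin n → ℝ} (ha : StrictAnti a)
    (hb : StrictAnti b) :
    Tendsto (fun s : ℝ => expDet (fun i => s * a i) b * Real.exp (-(s * ∑ i, a i * b i)))
      atTop (𝓝 1) := by
  have hexp : ∀ s : ℝ, expDet (fun i => s * a i) b * Real.exp (-(s * ∑ i, a i * b i)) =
      ∑ σ : Equiv.Perm (Fin n), (Equiv.Perm.sign σ : ℝ) *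
        Real.exp (s * (∑ i, a i * b (σ i) - ∑ i, a i * b i)) := by
    intro s
    rw [expDet, ← Matrix.det_transpose, Matrix.det_apply', Finset.sum_mul]
    refine Finset.sum_congr rfl fun σ _ => ?_
    simp only [Matrix.transpose_apply, Matrix.of_apply]
    rw [← Real.exp_sum, mul_assoc, ← Real.exp_add, mul_sub, sub_eq_add_neg]
    simp only [mul_assoc, Finset.mul_sum]
  simp only [hexp]
  rw [show (𝓝 (1 : ℝ)) = 𝓝 (∑ σ : Equiv.Perm (Fin n), if σ = 1 then 1 else 0) by simp]
  refine tendsto_finsetSum _ fun σ _ => ?_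
  split_ifs with h
  · simp [h]
  · have hneg := sub_neg.mpr (sum_mul_comp_perm_lt_of_strictAnti ha hb h)
    have := Real.tendsto_exp_atBot.comp (tendsto_id.atTop_mul_const_of_neg hneg)
    simpa using this.const_mul ((Equiv.Perm.sign σ : ℤ) : ℝ)

theorem sum_mul_le_of_expRatio_le {n : ℕ} {a b c : Fin n → ℝ} (ha : StrictAnti a)
    (hb : StrictAnti b) (hc : StrictAnti c)
    (h : ∀ s : ℝ, 0 < s → expRatio (fun i => s * a i) b ≤ expRatio (fun i => s * a i) c) :
    ∑ i, a i * b i ≤ ∑ i, a i * c i := by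
  by_contra! hlt
  have hb0 := alternantDet_zero_pos hb
  have h1 := (tendsto_expDet_mul_exp_neg ha hb).div_const (alternantDet b 0)
  have h2 := ((tendsto_expDet_mul_exp_neg ha hc).mul (Real.tendsto_exp_atBot.comp
    (tendsto_id.atTop_mul_const_of_neg (sub_neg.mpr hlt)))).div_const (alternantDet c 0)
  -- After scaling by `exp (-(s * ∑ a_i b_i))` the left side tends to `1 / alternantDet b 0 > 0`,
  -- while the right side tends to 0.
  have h3 := le_of_tendsto_of_tendsto h1 h2 ?_
  · rw [mul_zero, zero_div] at h3
    exact absurd h3 (not_le.mpr (by positivity))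
  · filter_upwards [eventually_gt_atTop 0] with s hs
    have h4 := mul_le_mul_of_nonneg_right (h s hs) (Real.exp_pos (-(s * ∑ i, a i * b i))).le
    simp only [Function.comp_apply, id_eq]
    rw [mul_assoc, ← Real.exp_add]
    rw [expRatio, expRatio, div_mul_eq_mul_div, div_mul_eq_mul_div] at h4
    convert h4 using 4
    ring

theorem sum_mul_le_of_normalizedSchur_le {n : ℕ} {l m : Fin n → ℕ} (hl : Antitone l)
    (hm : Antitone m)
    (h : ∀ x : Fin n → ℝ, (∀ i, 0 ≤ x i) → normalizedSchur l x ≤ normalizedSchur m x)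
    {a : Fin n → ℝ} (ha : Antitone a) : ∑ i, a i * l i ≤ ∑ i, a i * m i := by
  have key : ∀ t : ℝ, 0 < t → ∑ i, (a i + t * shiftedPart (0 : Fin n → ℕ) i) * l i ≤
      ∑ i, (a i + t * shiftedPart (0 : Fin n → ℕ) i) * m i := by
    intro t ht
    set a' : Fin n → ℝ := fun i => a i + t * shiftedPart (0 : Fin n → ℕ) i with ha'
    have hanti : StrictAnti a' := fun i j hij =>
      add_lt_add_of_le_of_lt (ha hij.le)
        (mul_lt_mul_of_pos_left (shiftedPart_zero_strictAnti hij) ht)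
    have := sum_mul_le_of_expRatio_le hanti (shiftedPart_strictAnti hl) (shiftedPart_strictAnti hm)
      fun s hs => (normalizedSchur_exp_le_iff l m fun i j hij =>
        mul_lt_mul_of_pos_left (hanti hij) hs).mp (h _ fun i => (Real.exp_pos _).le)
    -- The contributions of `shiftedPart 0` to the two sides are equal and cancel.
    simp only [shiftedPart_eq_add l, shiftedPart_eq_add m, mul_add, Finset.sum_add_distrib] at this
    linarith
  have hlim : ∀ p : Fin n → ℕ, Tendsto
      (fun t : ℝ => ∑ i, (a i + t * shiftedPart (0 : Fin n → ℕ) i) * p i)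
      (𝓝[>] 0) (𝓝 (∑ i, a i * p i)) := by
    intro p
    have : Continuous fun t : ℝ => ∑ i, (a i + t * shiftedPart (0 : Fin n → ℕ) i) * (p i : ℝ) := by
      fun_prop
    simpa using (this.tendsto 0).mono_left nhdsWithin_le_nhds
  exact le_of_tendsto_of_tendsto (hlim l) (hlim m)
    (eventually_nhdsWithin_of_forall fun t ht => key t ht)

theorem isMajorizedBy_of_sum_mul_le {n : ℕ} {l m : Fin n → ℕ}
    (h : ∀ a : Fin n → ℝ, Antitone a → ∑ i, a i * l i ≤ ∑ i, a i * m i) : IsMajorizedBy l m := by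
  refine ⟨fun k _ _ => ?_, ?_⟩
  -- Indicators of initial segments are decreasing and yield the partial sums; the constants 1 and
  -- -1 below yield equality of the totals.
  · have := h (fun i => if (i : ℕ) < k then 1 else 0) fun i j hij => by
      have := Fin.le_def.mp hij
      dsimp only
      split_ifs <;> first | omega | norm_num
    simp only [ite_mul, one_mul, zero_mul, ← Finset.sum_filter] at this
    exact_mod_cast this
  · have h1 := h (fun _ => 1) antitone_const
    have h2 := h (fun _ => -1) antitone_const
    simp only [one_mul, neg_mul, Finset.sum_neg_distrib, neg_le_neg_iff] at h1 h2
    exact_mod_cast le_antisymm h1 h2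

theorem mainTheorem3 (n : ℕ) (l m : Fin n → ℕ) (hl : Antitone l) (hm : Antitone m) :
    (∀ x : Fin n → ℝ, (∀ i, 0 ≤ x i) → normalizedSchur l x ≤ normalizedSchur m x) ↔
      IsMajorizedBy l m := by
  exact ⟨fun h => isMajorizedBy_of_sum_mul_le fun _ ha =>
      sum_mul_le_of_normalizedSchur_le hl hm h ha,
    fun h _ hx => normalizedSchur_le_of_isMajorizedBy hl hm h hx⟩
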